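/- Let $q=p^r=4m^2+1$, where $p$ is a prime with $p\equiv 1\pmod 4$, $r\ge 1$ and $m$ is an integer. Let $\omega$ be a primitive element of $\mathbb F_{q^2}$ (a generator of $\mathbb F_{q^2}^*$), and put $\zeta_4=e^{2\pi i/4}=i$. For $k\mid q^2-1$ and an integer $i\ge 0$ let $C_i^{(k,q^2)}=\omega^iC$, where $C$ is the subgroup of index $k$ of $\mathbb F_{q^2}^*$. Let $\eta$ be the multiplicative character of order $2$ of $\mathbb F_q$, let $\chi_4'$ be the multiplicative character of order $4$ of $\mathbb F_q$ with $\chi_4'(\omega^{q+1})=\zeta_4$ (both extended by $0$ at $0$), and let $J(\eta,\chi_4')=\sum_{x\in\mathbb F_q}\eta(x)\chi_4'(1-x)$. Then there are (necessarily unique) signs $\epsilon,\delta\in\{-1,1\}$ with $$J(\eta,\chi_4')=\epsilon+2m\delta\zeta_4 .$$ For $h\in\{0,1,2,3\}$ and an integer $\ell$, put $n=\omega^{\ell(q+1)}$ and $t=\omega^\ell+\omega^{\ell q}$ (both in $\mathbb F_q$), and call $(h,\ell)$ admissible if $\ell$ is not divisible by $q+1$ and $$\chi_4'(n)=\zeta_4^{\frac{-\epsilon\delta+1}{2}+h},\qquad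 \chi_4'(n-t^2/4)=-\zeta_4^{\epsilon+2h}.$$ An admissible pair exists with $h\in\{0,1,2,3\}$ and $\ell\in\{0,1,\dots,q^2-2\}$. For every admissible pair $(h,\ell)$, the set $$D_{\ell,h}=\{x\in\mathbb F_q : 1+x\omega^\ell\in C_h^{(4,q^2)}\cup C_{h+1}^{(4,q^2)}\}$$ satisfies $|D_{\ell,h}|=2m^2-m+1$ and $$\{\,|D_{\ell,h}\cap(S+s)| : s\in\mathbb F_q\,\}=\{m^2-m,\;m^2\},$$ where $S$ is the set of nonzero squares of $\mathbb F_q$ and $m^2-m\neq m^2$. That is, $D_{\ell,h}$ is a two-intersection set with parameters $(2m^2-m+1;\,m^2-m,\,m^2)$ for the block design with point set $\mathbb F_q$ and blocks $S+s$, $s\in\mathbb F_q$. -/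

import Mathlib

/-- The multiplicative subgroup of `k`-th powers in the unit group of a field `K`. If `K` is finite
and `k` divides `|Kˣ|`, this is *the* subgroup of `Kˣ` of index `k`; see
`index_eq_iff_eq_powSubgroup`. -/
def powSubgroup (K : Type*) [Field K] (k : ℕ) : Subgroup Kˣ :=
  (powMonoidHom k : Kˣ →* Kˣ).range

theorem index_eq_iff_eq_powSubgroup {K : Type*} [Field K] [Finite K] {k : ℕ}
    (hk : k ∣ Nat.card Kˣ) (H : Subgroup Kˣ) : H.index = k ↔ H = powSubgroup K k := by
  have hidx : (powSubgroup K k).index = k := by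
    unfold powSubgroup
    rw [IsCyclic.index_powMonoidHom_range]
    exact Nat.gcd_eq_right hk
  constructor
  · intro h
    have hle : powSubgroup K k ≤ H := by
      rintro x ⟨y, rfl⟩
      have := H.pow_index_mem y
      rw [h] at this
      simpa using this
    have h1 := Subgroup.relIndex_mul_index hle
    have hpos : 0 < H.index := Nat.pos_of_ne_zero H.index_ne_zero_of_finite
    rw [hidx, h] at h1
    have h2 : (powSubgroup K k).relIndex H = 1 := by
      rw [h] at hpos
      exact Nat.eq_of_mul_eq_mul_right hpos (by rw [h1, one_mul])
    exact le_antisymm (Subgroup.relIndex_eq_one.mp h2) hle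
  · rintro rfl
    exact hidx

/-- The cyclotomic class `C_i^{(k,|K|)} = ω^i C`, as a subset of `K`, where `C` is the subgroup of
index `k` of `Kˣ`. -/
def cyclotomicClass {K : Type*} [Field K] (ω : Kˣ) (k i : ℕ) : Set K :=
  {x | ∃ c ∈ powSubgroup K k, x = ((ω ^ i * c : Kˣ) : K)}

/-- `D` is a two-intersection set with parameters `(j; α, β)` for the block design whose point set
is `P` and whose set of blocks is `𝓑`. -/
def IsTwoIntersectionSet {P : Type*} (𝓑 : Set (Set P)) (D : Set P) (j α β : ℤ) : Prop :=
  (D.ncard : ℤ) = j ∧ α ≠ β ∧ {N : ℤ | ∃ B ∈ 𝓑, N = ((B ∩ D).ncard : ℤ)} = {α, β}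

/-- The set of nonzero squares of `F`. -/
def nonzeroSquares (F : Type*) [Field F] : Set F := {x | x ≠ 0 ∧ IsSquare x}

/-- The blocks `S + a`, `a ∈ F`, where `S` is the set of nonzero squares of `F`. -/
def squareTranslates (F : Type*) [Field F] : Set (Set F) :=
  {B | ∃ a : F, B = {y | ∃ x ∈ nonzeroSquares F, y = x + a}}

/-- `D_{ℓ,h} = {x ∈ F : 1 + x ω^ℓ ∈ C_h ∪ C_{h+1}}`, with `C_i` the quartic cyclotomic classes of
the extension `E` of `F`. -/
def quarticSet (F : Type*) {E : Type*} [Field F] [Field E] [Algebra F E]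
    (ω : Eˣ) (ℓ : ℤ) (h : ℕ) : Set F :=
  {x | 1 + algebraMap F E x * ((ω ^ ℓ : Eˣ) : E) ∈
    cyclotomicClass ω 4 h ∪ cyclotomicClass ω 4 (h + 1)}

/-- The admissible choices of `(h, ℓ)`: `h ∈ {0,1,2,3}`, `ℓ` is not divisible by `q + 1`
(`q = |F|`), and, with `n = ω^{ℓ(q+1)}` and `t = ω^ℓ + ω^{ℓq}`, which are elements of `F`,
`χ(n) = ζ₄^{(1 - εδ)/2 + h}` and `χ(n - t²/4) = -ζ₄^{ε + 2h}`. Here `ζ₄ = exp(2πi/4) = i`, and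
`ε, δ ∈ {-1, 1}`, so that the division by `2` in the exponent is exact. -/
def AdmissiblePair {F E : Type*} [Field F] [Field E] [Algebra F E]
    (ω : Eˣ) (χ : MulChar F ℂ) (ε δ : ℤ) (h : ℕ) (ℓ : ℤ) : Prop :=
  h < 4 ∧ ¬ ((Nat.card F : ℤ) + 1 ∣ ℓ) ∧
    ∃ n t : F,
      algebraMap F E n = ((ω ^ (ℓ * ((Nat.card F : ℤ) + 1)) : Eˣ) : E) ∧
      algebraMap F E t = ((ω ^ ℓ : Eˣ) : E) + ((ω ^ (ℓ * (Nat.card F : ℤ)) : Eˣ) : E) ∧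
      χ n = Complex.I ^ ((1 - ε * δ) / 2 + (h : ℤ)) ∧
      χ (n - t ^ 2 / 4) = -Complex.I ^ (ε + 2 * (h : ℤ))

open Finset

/-! The norm to `F` sends `ω` to a generator `g` with `χ g = i`, and `1 + xω^ℓ` to `P(x) = 1 + tx +
nx²`. Hence `x ∈ D` iff `u(x) = i^(-h) χ(P(x))` is `1` or `i`, an event with indicator `(1 + Re((1 -
i)u(x)))/2`. The size of `D` is thus governed by `∑ χ(P(x))`, and its intersection with `S + a` by
`∑ η(x - a)χ(P(x))`. Since `η = χ²`, both sums reduce to `J = J(η, χ)` (`sum_mulChar_quadratic`,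
`sum_quadraticChar_mul_mulChar_quadratic`).

Admissibility makes both sums carry the factor `i^ε J = i - 2mεδ`. The intersection number then
depends on `a` only through a sign `v(a)`, and `∑ v(a) = -(1 + 2m)` forces both signs to occur.

The form of `J` is arithmetic: `J` lies in `ℤ[i]`, has norm `q`, odd real part and even imaginary
part. Also `p ∤ J`, because a suitable reduction of `J` in `F` is a binomial coefficient prime to
`p`. As `q = 1 + (2m)²`, this leaves only `±1 ± 2mi`. -/

/-! ### Value of the Jacobi sum. -/

/-- With `q = p^r`, `(2ma - b)(2ma + b) = q(a² - 1)`. The odd prime `p` cannot divide both factors,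
so all of `q` divides one of them, and a size bound makes that factor zero. -/
theorem int_sq_add_sq_eq_prime_pow_cases {p r : ℕ} (hp : p.Prime) (hp2 : p ≠ 2) {a b m : ℤ}
    (hm : (p : ℤ) ^ r = 4 * m ^ 2 + 1) (hab : a ^ 2 + b ^ 2 = (p : ℤ) ^ r)
    (hr : r ≠ 0) (ha : Odd a) (hb : Even b) (hpab : ¬ ((p : ℤ) ∣ a ∧ (p : ℤ) ∣ b)) :
    (a = 1 ∨ a = -1) ∧ (b = 2 * m ∨ b = -(2 * m)) := by
  have hp' : Prime (p : ℤ) := Nat.prime_iff_prime_int.mp hp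
  have hpq : (p : ℤ) ∣ (p : ℤ) ^ r := dvd_pow_self _ hr
  have hprod : (p : ℤ) ^ r ∣ (2 * m * a - b) * (2 * m * a + b) :=
    ⟨a ^ 2 - 1, by rw [hm] at hab ⊢; linear_combination -hab⟩
  have hpb : ¬ (p : ℤ) ∣ b := by
    intro h
    refine hpab ⟨?_, h⟩
    refine hp'.dvd_of_dvd_pow (n := 2) ?_
    rw [show a ^ 2 = (p : ℤ) ^ r - b ^ 2 by linear_combination hab]
    exact dvd_sub hpq (dvd_pow h two_ne_zero)
  have hnot : ¬ ((p : ℤ) ∣ 2 * m * a - b ∧ (p : ℤ) ∣ 2 * m * a + b) := by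
    rintro ⟨h1, h2⟩
    have h3 : (p : ℤ) ∣ 2 * b := by
      have := dvd_sub h2 h1
      rwa [show 2 * m * a + b - (2 * m * a - b) = 2 * b by ring] at this
    rcases hp'.dvd_or_dvd h3 with h | h
    · have : p ∣ 2 := by exact_mod_cast h
      exact hp2 ((Nat.prime_dvd_prime_iff_eq hp Nat.prime_two).mp this)
    · exact hpb h
  have key : ∀ s : ℤ, Even s → a ^ 2 + s ^ 2 = (p : ℤ) ^ r → (p : ℤ) ^ r ∣ 2 * m * a - s →
      s = 2 * m * a := by
    rintro s hs has ⟨k, hk⟩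
    -- Brahmagupta's identity for the product of `1 + (2m)²` and `a² + s²`. The second square is
    -- odd, hence positive, so `|2ma - s| < q`.
    have hid : (2 * m * a - s) ^ 2 + (a + 2 * m * s) ^ 2 = ((p : ℤ) ^ r) ^ 2 := by
      rw [hm] at has ⊢; linear_combination (4 * m ^ 2 + 1) * has
    have hodd : a + 2 * m * s ≠ 0 := by
      intro h
      have : Even (2 * m * s) := hs.mul_left _
      have h2 : Odd (a + 2 * m * s) := ha.add_even this
      rw [h] at h2
      simp at h2
    have hlt : k ^ 2 < 1 := by
      have hpos : 0 < ((p : ℤ) ^ r) ^ 2 := by have := hp.pos; positivity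
      have : 0 < (a + 2 * m * s) ^ 2 := by positivity
      rw [hk] at hid
      by_contra! hk1
      nlinarith
    have : k = 0 := by
      by_contra hk0
      have : 0 < k ^ 2 := by positivity
      omega
    rw [this] at hk
    linarith
  have hor : b = 2 * m * a ∨ b = -(2 * m * a) := by
    by_cases h1 : (p : ℤ) ∣ 2 * m * a - b
    · have h2 : ¬ (p : ℤ) ∣ 2 * m * a + b := fun h => hnot ⟨h1, h⟩
      have hc : IsCoprime ((p : ℤ) ^ r) (2 * m * a + b) :=
        ((Prime.coprime_iff_not_dvd hp').mpr h2).pow_left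
      exact Or.inl (key b hb hab (hc.dvd_of_dvd_mul_right hprod))
    · have hc : IsCoprime ((p : ℤ) ^ r) (2 * m * a - b) :=
        ((Prime.coprime_iff_not_dvd hp').mpr h1).pow_left
      have := key (-b) hb.neg (by rw [neg_sq]; exact hab)
        (by rw [sub_neg_eq_add]; exact hc.dvd_of_dvd_mul_left hprod)
      exact Or.inr (by linarith)
  have ha1 : a ^ 2 = 1 := by
    have hb2 : b ^ 2 = 4 * m ^ 2 * a ^ 2 := by rcases hor with h | h <;> rw [h] <;> ring
    rw [hb2, hm] at hab
    have : (4 * m ^ 2 + 1) * (a ^ 2 - 1) = 0 := by linear_combination hab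
    rcases mul_eq_zero.mp this with h | h
    · nlinarith [sq_nonneg m]
    · linarith
  rcases _root_.sq_eq_one_iff.mp ha1 with rfl | rfl
  · exact ⟨Or.inl rfl, by simpa using hor⟩
  · exact ⟨Or.inr rfl, by simpa using hor.symm⟩

/-- All base-`p` digits of `k = (p^r - 1)/4` equal `c = (p - 1)/4`, so `3k` and `2k` have digits
`3c` and `2c`, without carries. Lucas' theorem leaves powers of `C(3c, 2c)`, and `3c < p`. -/
theorem not_dvd_choose_three_mul_two_mul {p : ℕ} (hp : p.Prime) (hp4 : p % 4 = 1) (r : ℕ) :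
    ∀ k, p ^ r = 4 * k + 1 → ¬ p ∣ (3 * k).choose (2 * k) := by
  have := Fact.mk hp
  obtain ⟨c, hc⟩ : ∃ c, p = 4 * c + 1 := ⟨p / 4, by omega⟩
  have hcp : 0 < c := by
    rcases Nat.eq_zero_or_pos c with h | h
    · exact absurd hp (by rw [hc, h]; norm_num)
    · exact h
  induction r with
  | zero =>
    intro k hk
    have : k = 0 := by simpa using hk
    subst this
    simpa using hp.one_lt.ne'
  | succ r ih =>
    intro k hk
    obtain ⟨k', hk'⟩ : ∃ k', p ^ r = 4 * k' + 1 := by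
      refine ⟨p ^ r / 4, ?_⟩
      have : p ^ r % 4 = 1 := by rw [Nat.pow_mod, hp4]; simp
      omega
    have hkk : k = p * k' + c := by
      have : 4 * k + 1 = (4 * k' + 1) * p := by rw [← hk, pow_succ, hk']
      have h2 : (4 * k' + 1) * p = 4 * (p * k') + p := by ring
      omega
    have h3 : 3 * k = 3 * c + p * (3 * k') := by rw [hkk]; ring
    have h2 : 2 * k = 2 * c + p * (2 * k') := by rw [hkk]; ring
    have hl := Choose.choose_modEq_choose_mod_mul_choose_div_nat (n := 3 * k) (k := 2 * k) (p := p)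
    have e1 : (3 * k) % p = 3 * c := by
      rw [h3, Nat.add_mul_mod_self_left, Nat.mod_eq_of_lt (by omega)]
    have e2 : (2 * k) % p = 2 * c := by
      rw [h2, Nat.add_mul_mod_self_left, Nat.mod_eq_of_lt (by omega)]
    have e3 : (3 * k) / p = 3 * k' := by
      rw [h3, Nat.add_mul_div_left _ _ hp.pos, Nat.div_eq_of_lt (by omega), zero_add]
    have e4 : (2 * k) / p = 2 * k' := by
      rw [h2, Nat.add_mul_div_left _ _ hp.pos, Nat.div_eq_of_lt (by omega), zero_add]
    rw [e1, e2, e3, e4] at hl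
    rw [hl.dvd_iff dvd_rfl, hp.dvd_mul]
    rintro (h | h)
    · have hd : p ∣ (3 * c).factorial := by
        rw [← Nat.choose_mul_factorial_mul_factorial (show 2 * c ≤ 3 * c by omega)]
        exact (h.mul_right _).mul_right _
      have := (hp.dvd_factorial).mp hd
      omega
    · exact ih k' hk' h

/-- `∑ x, x ^ (2k) (1 - x) ^ (3k) = - C(3k, 2k)` over a field with `4k + 1` elements. -/
theorem sum_pow_mul_one_sub_pow {F : Type*} [Field F] [Fintype F] {k : ℕ} (hk : 0 < k)
    (hF : Fintype.card F = 4 * k + 1) :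
    ∑ x : F, x ^ (2 * k) * (1 - x) ^ (3 * k) = -((3 * k).choose (2 * k) : F) := by
  classical
  -- A power sum vanishes unless `4k` divides its exponent; between `2k` and `5k` only `4k`
  -- qualifies.
  have hs : ∀ j ∈ range (3 * k + 1), ∑ x : F, x ^ (2 * k + j) = if j = 2 * k then -1 else 0 := by
    intro j hj
    rw [mem_range] at hj
    have hne : 2 * k + j ≠ 0 := by omega
    rw [← Finset.sum_subset (subset_univ (univ.map ⟨fun x : Fˣ => (x : F), Units.val_injective⟩))]
    · rw [sum_map]
      simp only [Function.Embedding.coeFn_mk]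
      have := FiniteField.sum_pow_units F (2 * k + j)
      rw [this, hF]
      refine if_congr ?_ rfl rfl
      rw [Nat.add_sub_cancel]
      constructor
      · rintro ⟨c, hc⟩
        have : c = 1 := by
          rcases c with _ | _ | c
          · omega
          · rfl
          · nlinarith
        subst this; omega
      · rintro rfl
        exact ⟨1, by ring⟩
    · intro x _ hx
      have : x = 0 := by
        by_contra h
        exact hx (mem_map.mpr ⟨Units.mk0 x h, mem_univ _, rfl⟩)
      rw [this, zero_pow hne]
  have he : ∀ x : F, x ^ (2 * k) * (1 - x) ^ (3 * k) =
      ∑ j ∈ range (3 * k + 1), (-1) ^ j * ((3 * k).choose j : F) * x ^ (2 * k + j) := by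
    intro x
    rw [sub_eq_neg_add, add_pow, mul_sum]
    refine sum_congr rfl fun j _ => ?_
    rw [neg_pow, one_pow, pow_add]; ring
  simp_rw [he]
  rw [sum_comm]
  simp_rw [← mul_sum]
  rw [sum_congr rfl (fun j hj => by rw [hs j hj])]
  rw [sum_eq_single (2 * k)]
  · simp
  · intro j _ hj; simp [hj]
  · intro h; exact absurd (mem_range.mpr (by omega)) h

/-- The generator `g` of the unit group of a field with `4k + 1` elements satisfies
`g ^ (2k) = -1`. -/
theorem generator_pow_two_mul_eq_neg_one {F : Type*} [Field F] [Fintype F] {k : ℕ} (hk : 0 < k)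
    (hF : Fintype.card F = 4 * k + 1) {g : Fˣ} (hg : ∀ x, x ∈ Subgroup.zpowers g) :
    (g : F) ^ (2 * k) = -1 := by
  classical
  have ho : orderOf g = 4 * k := by
    rw [orderOf_eq_card_of_forall_mem_zpowers hg, Nat.card_eq_fintype_card, Fintype.card_units, hF]
    simp
  have h1 : ((g : F) ^ (2 * k)) ^ 2 = 1 := by
    have : g ^ (4 * k) = 1 := by rw [← ho, pow_orderOf_eq_one]
    rw [← pow_mul, show 2 * k * 2 = 4 * k by ring]
    simpa using congrArg Units.val this
  rcases _root_.sq_eq_one_iff.mp h1 with h | h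
  · exfalso
    have : g ^ (2 * k) = 1 := Units.ext (by simpa using h)
    have := Nat.le_of_dvd (by omega) (orderOf_dvd_of_pow_eq_one this)
    omega
  · exact h

theorem jacobiSum_sq_self_eq {F : Type*} [Field F] [Fintype F] {p r : ℕ} {m : ℤ} (hp : p.Prime)
    (hp4 : p % 4 = 1) (hF : Fintype.card F = p ^ r) (hm : (Fintype.card F : ℤ) = 4 * m ^ 2 + 1)
    {g : Fˣ} (hg : ∀ x, x ∈ Subgroup.zpowers g) {χ : MulChar F ℂ} (hχ : χ g = Complex.I) :
    ∃ ε δ : ℤ, (ε = 1 ∨ ε = -1) ∧ (δ = 1 ∨ δ = -1) ∧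
      jacobiSum (χ ^ 2) χ = (ε : ℂ) + 2 * (m : ℂ) * (δ : ℂ) * Complex.I := by
  classical
  have hr : r ≠ 0 := by
    rintro rfl
    have := Fintype.one_lt_card (α := F)
    simp [hF] at this
  have hm0 : m ≠ 0 := by
    rintro rfl
    have := Fintype.one_lt_card (α := F)
    have : Fintype.card F = 1 := by exact_mod_cast (by simpa using hm : (Fintype.card F : ℤ) = 1)
    omega
  obtain ⟨k, hk⟩ : ∃ k : ℕ, (k : ℤ) = m ^ 2 := ⟨(m ^ 2).toNat, Int.toNat_of_nonneg (sq_nonneg m)⟩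
  have hk0 : 0 < k := by
    have : (0 : ℤ) < k := by rw [hk]; positivity
    exact_mod_cast this
  have hFk : Fintype.card F = 4 * k + 1 := by
    have : (Fintype.card F : ℤ) = 4 * k + 1 := by rw [hm, hk]
    exact_mod_cast this
  have hcu : Fintype.card Fˣ = 4 * k := by rw [Fintype.card_units, hFk]; simp
  -- `χ` is lifted to `ℤ[i]`, where parity and reduction modulo `p` make sense.
  let i : GaussianIntˣ := ⟨⟨0, 1⟩, ⟨0, -1⟩, by decide, by decide⟩
  have hi4 : i ^ 4 = 1 := Units.ext (by decide)
  have hi : i ∈ rootsOfUnity (Fintype.card Fˣ) GaussianInt := by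
    rw [mem_rootsOfUnity, hcu, pow_mul, hi4, one_pow]
  let χ₀ : MulChar F GaussianInt := MulChar.ofRootOfUnity hi hg
  have hχ₀ : χ₀ g = i := MulChar.ofRootOfUnity_spec hi hg
  have hlift : χ = χ₀.ringHomComp GaussianInt.toComplex := by
    rw [MulChar.eq_iff hg, MulChar.ringHomComp_apply, hχ₀, hχ]
    simp [i, GaussianInt.toComplex_def]
  have hJ : jacobiSum (χ ^ 2) χ = GaussianInt.toComplex (jacobiSum (χ₀ ^ 2) χ₀) := by
    rw [hlift, ← jacobiSum_ringHomComp, MulChar.ringHomComp_pow]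
  have hχ₀4 : χ₀ ^ 4 = 1 := by
    rw [MulChar.eq_iff hg, MulChar.pow_apply_coe, hχ₀, MulChar.one_apply_coe]
    simpa using congrArg Units.val hi4
  obtain ⟨z, -, hz⟩ := exists_jacobiSum_eq_neg_one_add (n := 4) (by norm_num) (χ := χ₀ ^ 2)
    (ψ := χ₀) (μ := (i : GaussianInt)) (by rw [← pow_mul, mul_comm, pow_mul, hχ₀4, one_pow]) hχ₀4
    (by rw [hFk]; simp)
    (by
      refine IsPrimitiveRoot.iff_def _ _ |>.mpr ⟨by decide, fun l hl => ?_⟩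
      have hq : (i : GaussianInt) ^ l = (i : GaussianInt) ^ (l % 4) := by
        conv_lhs => rw [← Nat.mod_add_div l 4, pow_add, pow_mul,
          show (i : GaussianInt) ^ 4 = 1 by decide]
        simp
      rw [hq] at hl
      have : l % 4 < 4 := Nat.mod_lt _ (by norm_num)
      apply Nat.dvd_of_mod_eq_zero
      generalize l % 4 = c at *
      interval_cases c
      · rfl
      all_goals exact absurd hl (by decide))
  set J := jacobiSum (χ₀ ^ 2) χ₀ with hJdef
  -- The congruence `J ≡ -1` modulo `(i - 1)² = -2i` gives the parities of both coordinates.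
  have hi12 : ((i : GaussianInt) - 1) ^ 2 = ⟨0, -2⟩ := by decide
  rw [hi12] at hz
  have hre : Odd J.re := by
    rw [hz]; simp [Zsqrtd.re_mul]
    exact ⟨-1 + z.im, by ring⟩
  have him : Even J.im := by
    rw [hz]; simp [Zsqrtd.im_mul]
  have hnorm : J.re ^ 2 + J.im ^ 2 = (p : ℤ) ^ r := by
    have hconj : χ⁻¹ = χ.ringHomComp (starRingEnd ℂ) := by
      rw [MulChar.eq_iff hg, MulChar.inv_apply_eq_inv', MulChar.ringHomComp_apply, hχ]
      simp
    have hχ2 : (χ ^ 2) g = -1 := by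
      rw [MulChar.pow_apply_coe, hχ, Complex.I_sq]
    have h := jacobiSum_mul_jacobiSum_inv (F := F) (F' := ℂ) (χ := χ ^ 2) (φ := χ)
      (by
        rw [ringChar.eq_zero]
        exact (CharP.ringChar_ne_zero_of_finite F).symm)
      (by
        intro h
        rw [h, MulChar.one_apply_coe] at hχ2
        norm_num at hχ2)
      (by
        intro h
        rw [h, MulChar.one_apply_coe] at hχ
        simpa using congrArg Complex.re hχ)
      (by
        intro h
        have : (χ ^ 2 * χ) g = 1 := by rw [h, MulChar.one_apply_coe]
        rw [MulChar.mul_apply, hχ2, hχ] at this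
        simpa using congrArg Complex.re this)
    rw [← inv_pow, hconj, MulChar.ringHomComp_pow, jacobiSum_ringHomComp, hJ, Complex.mul_conj,
      hF] at h
    have h' := congrArg Complex.re h
    rw [Complex.ofReal_re, Complex.normSq_apply, ← GaussianInt.intCast_re,
      ← GaussianInt.intCast_im] at h'
    push_cast at h'
    rw [← Nat.cast_pow, Complex.natCast_re] at h'
    rw [pow_two, pow_two]
    exact_mod_cast h'
  have hpJ : ¬ ((p : ℤ) ∣ J.re ∧ (p : ℤ) ∣ J.im) := by
    rintro ⟨⟨x, hx⟩, ⟨y, hy⟩⟩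
    have hpF : (p : F) = 0 := by
      have := FiniteField.cast_card_eq_zero F
      rw [hF, Nat.cast_pow] at this
      exact pow_eq_zero_iff hr |>.mp this
    have hg2 := generator_pow_two_mul_eq_neg_one hk0 hFk hg
    -- The choice of root of `-1` matters: `i ↦ g^(3k)` turns `χ` into `x^(3k)`, while `i ↦ g^k`
    -- would give a sum of degree `3k < q - 1`, which vanishes.
    let f : GaussianInt →+* F := Zsqrtd.lift ⟨(g : F) ^ (3 * k), by
      rw [← pow_add, show 3 * k + 3 * k = 2 * k * 3 by ring, pow_mul, hg2]; norm_num⟩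
    have hfi : f i = (g : F) ^ (3 * k) := by
      simp [f, i]
    have hfχ : ∀ x : Fˣ, f (χ₀ x) = (x : F) ^ (3 * k) := by
      intro x
      obtain ⟨n, rfl⟩ := mem_powers_iff_mem_zpowers.mpr (hg x)
      simp only [Units.val_pow_eq_pow_val, map_pow, hχ₀, hfi]
      rw [← pow_mul, ← pow_mul, mul_comm]
    have hfχ0 : ∀ x : F, f (χ₀ x) = x ^ (3 * k) := by
      intro x
      by_cases h : x = 0
      · rw [h, MulChar.map_zero, map_zero, zero_pow (by omega)]
      · exact hfχ (Units.mk0 x h)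
    have hfJ : f J = ∑ x : F, x ^ (2 * k) * (1 - x) ^ (3 * k) := by
      rw [hJdef, jacobiSum, map_sum]
      refine sum_congr rfl fun x _ => ?_
      rw [map_mul, hfχ0, MulChar.pow_apply' _ two_ne_zero, map_pow, hfχ0]
      by_cases h : x = 0
      · rw [h, zero_pow (by omega), zero_pow (by omega), zero_pow (by omega)]
      · have : x ^ (4 * k) = 1 := by
          have := FiniteField.pow_card_sub_one_eq_one x h
          rwa [hFk, Nat.add_sub_cancel] at this
        rw [← pow_mul, show 3 * k * 2 = 4 * k + 2 * k by ring, pow_add, this, one_mul]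
    rw [sum_pow_mul_one_sub_pow hk0 hFk] at hfJ
    have hJp : J = (p : GaussianInt) * ⟨x, y⟩ := by
      ext <;> simp [hx, hy]
    rw [hJp, map_mul, map_natCast, hpF, zero_mul, eq_comm, neg_eq_zero] at hfJ
    have hcp : CharP F p := by
      refine (CharP.charP_iff_prime_eq_zero hp).mpr hpF
    exact not_dvd_choose_three_mul_two_mul hp hp4 r k (by rw [← hF, hFk])
      ((CharP.cast_eq_zero_iff F p _).mp hfJ)
  have hcard : (p : ℤ) ^ r = 4 * m ^ 2 + 1 := by rw [← hm, hF]; push_cast; rfl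
  obtain ⟨h1, h2⟩ := int_sq_add_sq_eq_prime_pow_cases hp (by rintro rfl; omega) hcard hnorm hr hre
    him hpJ
  rw [hJ, GaussianInt.toComplex_def]
  refine ⟨J.re, if J.im = 2 * m then 1 else -1, h1, by split_ifs <;> simp, ?_⟩
  split_ifs with h
  · rw [h]; push_cast; ring
  · rw [h2.resolve_left h]; push_cast; ring

/-! ### Character sums of quadratic polynomials. -/

section QuadraticPolynomialSums

variable {F : Type*} [Field F] [Fintype F] [DecidableEq F]

theorem sum_comp_sq {R : Type*} [CommRing R] (hF : ringChar F ≠ 2) (f : F → R) :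
    ∑ y : F, f (y ^ 2) = ∑ u : F, f u * (1 + (quadraticChar F u : R)) := by
  rw [← sum_fiberwise univ (fun y : F => y ^ 2) (fun y => f (y ^ 2))]
  refine sum_congr rfl fun u _ => ?_
  rw [sum_congr rfl (g := fun _ => f u) (fun y hy => by rw [(mem_filter.mp hy).2]), sum_const,
    nsmul_eq_mul, mul_comm]
  have h := quadraticChar_card_sqrts hF u
  rw [Set.toFinset_ofPred] at h
  have h' : ((#{x : F | x ^ 2 = u} : ℤ) : R) = ((quadraticChar F u + 1 : ℤ) : R) := by rw [h]
  push_cast at h'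
  rw [h', add_comm]

variable {R : Type*} [Field R] {χ : MulChar F R}

/-- Each `u` has `1 + η(u)` square roots. The constant part sums to zero, and `u = -dv` turns the
rest into a Jacobi sum. -/
theorem sum_mulChar_sq_add (hF : ringChar F ≠ 2) (hχ : χ ≠ 1) {d : F} (hd : d ≠ 0) :
    ∑ x : F, χ (x ^ 2 + d) = (quadraticChar F (-d) : R) * χ d *
      jacobiSum ((quadraticChar F).ringHomComp (Int.castRingHom R)) χ := by
  rw [sum_comp_sq hF (fun u => χ (u + d))]
  simp_rw [mul_add, mul_one]
  rw [sum_add_distrib, show ∑ x, χ (x + d) = ∑ x, χ x from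
      Equiv.sum_comp (Equiv.addRight d) (fun x => χ x),
    MulChar.sum_eq_zero_of_ne_one hχ, zero_add, jacobiSum, mul_sum,
    ← Equiv.sum_comp (Equiv.mulLeft₀ (-d) (neg_ne_zero.mpr hd))]
  refine sum_congr rfl fun v _ => ?_
  rw [Equiv.mulLeft₀_apply, show -d * v + d = d * (1 - v) by ring, map_mul, map_mul,
    MulChar.ringHomComp_apply, eq_intCast]
  push_cast
  ring

theorem sum_mulChar_quadratic (hF : ringChar F ≠ 2) (hχ : χ ≠ 1) {n t c : F} (hn : n ≠ 0)
    (hD : n * c - t ^ 2 / 4 ≠ 0) :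
    ∑ x : F, χ (c + t * x + n * x ^ 2) = (χ n)⁻¹ * χ (n * c - t ^ 2 / 4) *
      (quadraticChar F (-(n * c - t ^ 2 / 4)) : R) *
      jacobiSum ((quadraticChar F).ringHomComp (Int.castRingHom R)) χ := by
  have h2 : (2 : F) ≠ 0 := Ring.two_ne_zero hF
  have h4 : (4 : F) ≠ 0 := by
    rw [show (4 : F) = 2 * 2 by norm_num]; exact mul_ne_zero h2 h2
  set D := n * c - t ^ 2 / 4 with hDdef
  have hχn : χ n ≠ 0 := (hn.isUnit.map χ).ne_zero
  rw [← Equiv.sum_comp (Equiv.subRight (t / (2 * n)))]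
  have hx : ∀ y : F, χ (c + t * (Equiv.subRight (t / (2 * n)) y) +
      n * (Equiv.subRight (t / (2 * n)) y) ^ 2) = χ n * χ (y ^ 2 + D / n ^ 2) := by
    intro y
    rw [← map_mul, Equiv.subRight_apply, hDdef]
    congr 1
    field_simp
    ring
  simp_rw [hx]
  have hinv : (n⁻¹) ≠ 0 := inv_ne_zero hn
  rw [← mul_sum, sum_mulChar_sq_add hF hχ (div_ne_zero hD (pow_ne_zero 2 hn)),
    show -(D / n ^ 2) = -D * (n⁻¹) ^ 2 by field_simp, map_mul (quadraticChar F),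
    quadraticChar_sq_one' hinv, div_eq_mul_inv, map_mul, ← inv_pow, map_pow]
  have : χ n⁻¹ = (χ n)⁻¹ := by rw [← MulChar.inv_apply', MulChar.inv_apply_eq_inv']
  rw [this, mul_one]
  field_simp

/-- Substituting `x = a + 1/y` reverses the coefficients of the translated quadratic. The factors
`η(1/y)` and `χ(y⁻²) = η(1/y)` cancel, leaving a sum without `η`. -/
theorem sum_quadraticChar_mul_mulChar_quadratic (hF : ringChar F ≠ 2) (hχ : χ ≠ 1)
    (hχ2 : χ ^ 2 = (quadraticChar F).ringHomComp (Int.castRingHom R)) {n t c a : F}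
    (hc : c + t * a + n * a ^ 2 ≠ 0) (hD : n * c - t ^ 2 / 4 ≠ 0) :
    ∑ x : F, (quadraticChar F (x - a) : R) * χ (c + t * x + n * x ^ 2) =
      (χ (c + t * a + n * a ^ 2))⁻¹ * χ (n * c - t ^ 2 / 4) *
        (quadraticChar F (-(n * c - t ^ 2 / 4)) : R) *
        jacobiSum ((quadraticChar F).ringHomComp (Int.castRingHom R)) χ - χ n := by
  have h2 : (2 : F) ≠ 0 := Ring.two_ne_zero hF
  have h4 : (4 : F) ≠ 0 := by
    rw [show (4 : F) = 2 * 2 by norm_num]; exact mul_ne_zero h2 h2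
  set e := c + t * a + n * a ^ 2 with he
  -- Translation and reversal preserve the discriminant.
  have hDe : e * n - (t + 2 * n * a) ^ 2 / 4 = n * c - t ^ 2 / 4 := by
    rw [he]; field_simp; ring
  have hq := sum_mulChar_quadratic (χ := χ) hF hχ (n := e) (t := t + 2 * n * a) (c := n) hc
    (by rwa [hDe])
  rw [hDe] at hq
  rw [← hq, ← Equiv.sum_comp (Equiv.addRight a), eq_sub_iff_add_eq]
  have hcomp : ∀ y : F, (quadraticChar F (y : F) : R) = χ y ^ 2 := by
    intro y
    rw [← MulChar.pow_apply' _ two_ne_zero, hχ2, MulChar.ringHomComp_apply]; rfl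
  -- Inversion misses `0`: there the left sum has term `0` and the right one `χ n`, whence the
  -- correction `-χ n`.
  rw [← add_sum_erase univ _ (mem_univ (0 : F)),
    ← add_sum_erase univ (fun x => χ (n + _ * x + _)) (mem_univ (0 : F))]
  simp only [Equiv.coe_addRight, add_sub_cancel_right, sub_self, MulChar.map_zero, Int.cast_zero,
    zero_mul, zero_add, mul_zero, add_zero, ne_eq, OfNat.ofNat_ne_zero, not_false_eq_true, zero_pow]
  rw [add_comm]
  congr 1
  refine sum_bij' (fun (y : F) _ => y⁻¹) (fun (y : F) _ => y⁻¹) ?_ ?_ ?_ ?_ ?_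
  · intro y hy; simpa using hy
  · intro y hy; simpa using hy
  · intro y hy; simp
  · intro y hy; simp
  · intro y hy
    have hy0 : y ≠ 0 := (mem_erase.mp hy).1
    rw [hcomp, ← map_pow, ← map_mul, show c + t * (y + a) + n * (y + a) ^ 2 =
      (n + (t + 2 * n * a) * y⁻¹ + e * y⁻¹ ^ 2) * y ^ 2 by rw [he]; field_simp; ring,
      mul_left_comm, ← pow_add, map_mul, show 2 + 2 = 2 * 2 from rfl, pow_mul, map_pow, ← hcomp,
      quadraticChar_sq_one' hy0]
    simp

end QuadraticPolynomialSums

/-! ### Counting `D` and its intersections with the blocks. -/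

theorem eq_quadraticChar_of_generator {F : Type*} [Field F] [Fintype F] [DecidableEq F]
    {R : Type*} [CommRing R] (hF : ringChar F ≠ 2) {g : Fˣ}
    (hg : ∀ x, x ∈ Subgroup.zpowers g) {η : MulChar F R} (hη : η g = -1) :
    η = (quadraticChar F).ringHomComp (Int.castRingHom R) := by
  have hqg : quadraticChar F g = -1 := by
    refine (quadraticChar_dichotomy g.ne_zero).resolve_left fun h => ?_
    exact quadraticChar_ne_one hF ((MulChar.eq_iff hg _ _).mpr (by rw [h, MulChar.one_apply_coe]))
  rw [MulChar.eq_iff hg, hη, MulChar.ringHomComp_apply, hqg]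
  simp

theorem Set.cast_ncard_eq_sum_ite {α : Type*} [Fintype α] (D : Set α) [DecidablePred (· ∈ D)] :
    (D.ncard : ℝ) = ∑ x, if x ∈ D then (1 : ℝ) else 0 := by
  rw [Finset.sum_boole, Set.ncard_eq_toFinset_card']
  congr 2
  ext x
  simp

theorem Complex.eq_of_pow_four_eq_one {u : ℂ} (hu : u ^ 4 = 1) :
    u = 1 ∨ u = Complex.I ∨ u = -1 ∨ u = -Complex.I := by
  have : (u - 1) * ((u - I) * ((u + 1) * (u + I))) = 0 := by
    linear_combination hu - (u ^ 2 - 1) * Complex.I_sq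
  rcases mul_eq_zero.mp this with h | h
  · exact Or.inl (sub_eq_zero.mp h)
  rcases mul_eq_zero.mp h with h | h
  · exact Or.inr (Or.inl (sub_eq_zero.mp h))
  rcases mul_eq_zero.mp h with h | h
  · exact Or.inr (Or.inr (Or.inl (eq_neg_of_add_eq_zero_left h)))
  · exact Or.inr (Or.inr (Or.inr (eq_neg_of_add_eq_zero_left h)))

/-- The number of points of `D` in the translate `S + a` of the nonzero squares. -/
theorem two_mul_ncard_squareTranslate_inter {F : Type*} [Field F] [Fintype F] [DecidableEq F]
    (D : Set F) [DecidablePred (· ∈ D)] (a : F) :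
    2 * (({y | ∃ x ∈ nonzeroSquares F, y = x + a} ∩ D : Set F).ncard : ℝ) =
      D.ncard + ∑ x, (quadraticChar F (x - a) : ℝ) * (if x ∈ D then 1 else 0) -
        if a ∈ D then 1 else 0 := by
  classical
  rw [Set.cast_ncard_eq_sum_ite, Set.cast_ncard_eq_sum_ite, mul_sum, ← sum_add_distrib,
    eq_sub_iff_add_eq, ← Fintype.sum_ite_eq' a (fun x => if x ∈ D then (1 : ℝ) else 0),
    ← sum_add_distrib]
  refine sum_congr rfl fun x _ => ?_
  have hmem : x ∈ {y | ∃ z ∈ nonzeroSquares F, y = z + a} ↔ x ≠ a ∧ IsSquare (x - a) := by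
    constructor
    · rintro ⟨z, ⟨h1, h2⟩, rfl⟩
      simpa using ⟨h1, h2⟩
    · rintro ⟨h1, h2⟩
      exact ⟨x - a, ⟨sub_ne_zero.mpr h1, h2⟩, by ring⟩
  by_cases hD : x ∈ D
  · by_cases hxa : x = a
    · subst hxa
      simp [hD, Set.mem_inter_iff, hmem]
    · have hne : x - a ≠ 0 := sub_ne_zero.mpr hxa
      simp only [Set.mem_inter_iff, hmem, hD, hxa]
      by_cases hs : IsSquare (x - a)
      · rw [(quadraticChar_one_iff_isSquare hne).mpr hs]
        simp [hs, hxa]; norm_num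
      · rw [quadraticChar_neg_one_iff_not_isSquare.mpr hs]
        simp [hs]
  · simp [hD, Set.mem_inter_iff]

theorem isTwoIntersectionSet_of_quartic_mulChar {F : Type*} [Field F] [Fintype F]
    [DecidableEq F] {m : ℤ} (hF : ringChar F ≠ 2)
    (hm : (Fintype.card F : ℤ) = 4 * m ^ 2 + 1) {χ : MulChar F ℂ} (hχ1 : χ ≠ 1)
    (hχ2 : χ ^ 2 = (quadraticChar F).ringHomComp (Int.castRingHom ℂ)) (hneg : IsSquare (-1 : F))
    {ε δ : ℤ} (hε : ε = 1 ∨ ε = -1) (hδ : δ = 1 ∨ δ = -1)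
    (hJ : jacobiSum (χ ^ 2) χ = (ε : ℂ) + 2 * (m : ℂ) * (δ : ℂ) * Complex.I) {h : ℕ} {n t : F}
    (hn : χ n = Complex.I ^ ((1 - ε * δ) / 2 + (h : ℤ)))
    (hD : χ (n - t ^ 2 / 4) = -Complex.I ^ (ε + 2 * (h : ℤ))) :
    (∀ x, 1 + t * x + n * x ^ 2 ≠ 0) ∧ IsTwoIntersectionSet (squareTranslates F)
      {x | χ (1 + t * x + n * x ^ 2) = Complex.I ^ h ∨
        χ (1 + t * x + n * x ^ 2) = Complex.I ^ (h + 1)}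
      (2 * m ^ 2 - m + 1) (m ^ 2 - m) (m ^ 2) := by
  classical
  have h2 : (2 : F) ≠ 0 := Ring.two_ne_zero hF
  have h4 : (4 : F) ≠ 0 := by
    rw [show (4 : F) = 2 * 2 by norm_num]; exact mul_ne_zero h2 h2
  have hm0 : m ≠ 0 := by
    rintro rfl
    have := Fintype.one_lt_card (α := F)
    have : Fintype.card F = 1 := by exact_mod_cast (by simpa using hm : (Fintype.card F : ℤ) = 1)
    omega
  have hI0 := Complex.I_ne_zero
  have hχq : ∀ y : F, χ y ^ 2 = (quadraticChar F y : ℂ) := by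
    intro y
    rw [← MulChar.pow_apply' _ two_ne_zero, hχ2, MulChar.ringHomComp_apply]; rfl
  set w : ℂ := Complex.I ^ h with hw
  have hw0 : w ≠ 0 := pow_ne_zero _ hI0
  have hw4 : w ^ 4 = 1 := by rw [hw, ← pow_mul, mul_comm, pow_mul, Complex.I_pow_four, one_pow]
  rw [zpow_add₀ hI0, zpow_natCast, ← hw] at hn
  rw [zpow_add₀ hI0, zpow_mul, zpow_natCast, zpow_ofNat, ← pow_mul, mul_comm 2 h, pow_mul, ← hw]
    at hD
  set c : ℂ := Complex.I ^ ((1 - ε * δ) / 2) with hc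
  have hc0 : c ≠ 0 := zpow_ne_zero _ hI0
  have hn0 : n ≠ 0 := by
    rintro rfl
    rw [MulChar.map_zero] at hn
    exact mul_ne_zero hc0 hw0 hn.symm
  set d := n - t ^ 2 / 4 with hd
  -- `χ(d)² = -1` makes `d` a nonsquare, hence also `-d`. A root `x` of `P` would give `-d = (nx +
  -- t/2)²`.
  have hqd : quadraticChar F (-d) = -1 := by
    have hq1 : quadraticChar F (-1) = 1 :=
      (quadraticChar_one_iff_isSquare (neg_ne_zero.mpr one_ne_zero)).mpr hneg
    have : ((quadraticChar F d : ℤ) : ℂ) = -1 := by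
      rw [← hχq, hD]
      rcases hε with rfl | rfl
      · rw [zpow_one]; linear_combination Complex.I ^ 2 * hw4 + Complex.I_sq
      · rw [zpow_neg_one, Complex.inv_I]; linear_combination Complex.I ^ 2 * hw4 + Complex.I_sq
    rw [← neg_one_mul, map_mul, hq1, one_mul]
    exact_mod_cast this
  have hd0 : d ≠ 0 := by
    intro h0
    rw [h0, neg_zero, MulChar.map_zero] at hqd
    norm_num at hqd
  have hP : ∀ x, 1 + t * x + n * x ^ 2 ≠ 0 := by
    intro x hx
    apply quadraticChar_neg_one_iff_not_isSquare.mp hqd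
    refine ⟨n * x + t / 2, ?_⟩
    rw [hd]
    field_simp
    linear_combination -16 * n * hx
  refine ⟨hP, ?_⟩
  set P : F → F := fun x => 1 + t * x + n * x ^ 2 with hPdef
  set D : Set F := {x | χ (1 + t * x + n * x ^ 2) = w ∨
        χ (1 + t * x + n * x ^ 2) = Complex.I ^ (h + 1)} with hDdef
  let u : F → ℂ := fun x => w⁻¹ * χ (P x)
  have hu : ∀ x, u x = 1 ∨ u x = Complex.I ∨ u x = -1 ∨ u x = -Complex.I := by
    intro x
    apply Complex.eq_of_pow_four_eq_one
    have : χ (P x) ^ 4 = 1 := by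
      rw [show 4 = 2 * 2 from rfl, pow_mul, hχq]
      exact_mod_cast quadraticChar_sq_one (hP x)
    rw [mul_pow, this, inv_pow, hw4]; norm_num
  have hmem : ∀ x, x ∈ D ↔ u x = 1 ∨ u x = Complex.I := by
    intro x
    rw [hDdef, Set.mem_ofPred_eq, pow_succ Complex.I, ← hw]
    refine or_congr ?_ ?_
    · rw [inv_mul_eq_one₀ hw0, eq_comm]
    · rw [inv_mul_eq_iff_eq_mul₀ hw0]
  have hind : ∀ x, (if x ∈ D then (1 : ℝ) else 0) = (1 + ((1 - Complex.I) * u x).re) / 2 := by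
    intro x
    rw [if_congr (hmem x) rfl rfl]
    rcases hu x with h | h | h | h <;> rw [h] <;> norm_num [Complex.ext_iff]
  set s := ε * δ with hs
  have hs1 : s = 1 ∨ s = -1 := by
    rcases hε with rfl | rfl <;> rcases hδ with rfl | rfl <;> simp [hs]
  -- Multiplying by `i^ε` makes the value depend on the signs only through `s = εδ`.
  have hK : Complex.I ^ ε * jacobiSum (χ ^ 2) χ = Complex.I - 2 * m * s := by
    rw [hJ, hs]
    rcases hε with rfl | rfl
    · rw [zpow_one]; push_cast; linear_combination 2 * (m : ℂ) * δ * Complex.I_sq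
    · rw [zpow_neg_one, Complex.inv_I]; push_cast
      linear_combination -2 * (m : ℂ) * δ * Complex.I_sq
  have hA : ∑ x, u x = c⁻¹ * (Complex.I - 2 * m * s) := by
    have := sum_mulChar_quadratic hF hχ1 (t := t) (c := 1) hn0 (by rwa [mul_one])
    rw [mul_one, ← hd, hqd, ← hχ2, hn, hD] at this
    rw [← mul_sum, this, ← hK]
    push_cast
    field_simp
  have hB : ∀ a, ∑ x, (quadraticChar F (x - a) : ℂ) * u x =
      (u a)⁻¹ * (Complex.I - 2 * m * s) - c := by
    intro a
    have := sum_quadraticChar_mul_mulChar_quadratic hF hχ1 hχ2 (t := t) (c := 1) (n := n) (hP a)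
      (by rwa [mul_one])
    rw [mul_one, ← hd, hqd, ← hχ2, hn, hD] at this
    have hχa : χ (P a) ≠ 0 := ((hP a).isUnit.map χ).ne_zero
    simp_rw [u, mul_left_comm _ w⁻¹]
    rw [← mul_sum, this, ← hK]
    simp only [hPdef] at hχa ⊢
    push_cast
    field_simp
  have hcard : (D.ncard : ℝ) = 2 * m ^ 2 - m + 1 := by
    rw [Set.cast_ncard_eq_sum_ite]
    simp_rw [hind]
    rw [← sum_div, sum_add_distrib, ← Complex.re_sum, ← mul_sum, hA, sum_const, card_univ,
      nsmul_eq_mul, mul_one]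
    have hm' : (Fintype.card F : ℝ) = 4 * m ^ 2 + 1 := by exact_mod_cast hm
    rw [hm']
    rcases hs1 with h | h <;> rw [hc, h] <;> norm_num <;> ring
  -- The indicator of `a ∈ D` cancels the `Re((1 - i)u(a))/2` coming from the `i` in `i - 2ms`. Only
  -- `Re((1 + i)u(a)) = ±1` survives, so two values remain instead of four.
  have hN : ∀ a, 2 * (({y | ∃ x ∈ nonzeroSquares F, y = x + a} ∩ D : Set F).ncard : ℝ) =
      2 * m ^ 2 - m - m * s * ((1 + Complex.I) * u a).re := by
    intro a
    rw [two_mul_ncard_squareTranslate_inter, hcard]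
    have hsum : ∑ x, (quadraticChar F (x - a) : ℝ) * (if x ∈ D then 1 else 0) =
        ((1 - Complex.I) * ((u a)⁻¹ * (Complex.I - 2 * m * s) - c)).re / 2 := by
      simp_rw [hind]
      have h0 : ∑ x, (quadraticChar F (x - a) : ℝ) = 0 := by
        rw [← Int.cast_sum, show ∑ x, quadraticChar F (x - a) = ∑ x, quadraticChar F x from
            Equiv.sum_comp (Equiv.subRight a) (fun x => quadraticChar F x),
          quadraticChar_sum_zero hF, Int.cast_zero]
      have h1 : ∑ x, (quadraticChar F (x - a) : ℝ) * ((1 - Complex.I) * u x).re =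
          ((1 - Complex.I) * ((u a)⁻¹ * (Complex.I - 2 * m * s) - c)).re := by
        rw [← hB, mul_sum, Complex.re_sum]
        refine sum_congr rfl fun x _ => ?_
        rw [mul_left_comm (1 - Complex.I) (quadraticChar F (x - a) : ℂ),
          ← Complex.ofReal_intCast, Complex.re_ofReal_mul]
      simp_rw [mul_div_assoc', mul_add, mul_one]
      rw [← sum_div, sum_add_distrib, h0, h1, zero_add]
    rw [hsum, hind]
    rcases hs1 with h | h <;> rcases hu a with h' | h' | h' | h' <;> rw [hc, h, h'] <;>
      norm_num <;> ring
  have hv : ∀ a, ∃ v : ℤ, (v = 1 ∨ v = -1) ∧ ((1 + Complex.I) * u a).re = s * v := by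
    intro a
    rcases hs1 with h | h <;> rcases hu a with h' | h' | h' | h' <;> rw [h, h']
    · exact ⟨1, by simp⟩
    · exact ⟨-1, by simp⟩
    · exact ⟨-1, by simp⟩
    · exact ⟨1, by simp⟩
    · exact ⟨-1, by simp⟩
    · exact ⟨1, by simp⟩
    · exact ⟨1, by simp⟩
    · exact ⟨-1, by simp⟩
  choose v hv1 hv using hv
  have hss : (s : ℝ) * s = 1 := by rcases hs1 with h | h <;> rw [h] <;> norm_num
  have hsumv : ∑ a, v a = -(1 + 2 * m) := by
    have h1 : ∑ a, (s : ℝ) * (v a) = -s * (1 + 2 * m) := by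
      simp_rw [← hv]
      rw [← Complex.re_sum, ← mul_sum, hA]
      rcases hs1 with h | h <;> rw [hc, h] <;> norm_num <;> ring
    rw [← mul_sum] at h1
    have h3 : ∑ a, (v a : ℝ) = -(1 + 2 * m) := by
      linear_combination (s : ℝ) * h1 - (∑ a, (v a : ℝ) + (1 + 2 * m)) * hss
    exact_mod_cast h3
  have hNv : ∀ a, 2 * (({y | ∃ x ∈ nonzeroSquares F, y = x + a} ∩ D : Set F).ncard : ℤ) =
      2 * m ^ 2 - m - m * v a := by
    intro a
    have h1 := hN a
    rw [hv] at h1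
    have h3 : 2 * (({y | ∃ x ∈ nonzeroSquares F, y = x + a} ∩ D : Set F).ncard : ℝ) =
      2 * m ^ 2 - m - m * v a := by linear_combination h1 - m * v a * hss
    exact_mod_cast h3
  refine ⟨by exact_mod_cast hcard, by intro h; apply hm0; linarith, ?_⟩
  -- A constant `v` would give `-(1 + 2m) = ±(4m² + 1)`, impossible for an integer `m ≠ 0`.
  have hconst : ∀ e : ℤ, (e = 1 ∨ e = -1) → ∃ a, v a = e := by
    intro e he
    by_contra! hne
    have : ∀ a, v a = -e := by
      intro a
      rcases hv1 a with h | h <;> rcases he with h' | h' <;> have := hne a <;> omega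
    simp_rw [this] at hsumv
    rw [sum_const, card_univ, nsmul_eq_mul, hm] at hsumv
    rcases he with rfl | rfl
    · have : m * (2 * m - 1) = 0 := by linarith
      rcases mul_eq_zero.mp this with h | h <;> omega
    · nlinarith [sq_nonneg (m + 1), sq_nonneg m]
  ext N
  simp only [Set.mem_ofPred_eq, Set.mem_insert_iff, Set.mem_singleton_iff, squareTranslates]
  constructor
  · rintro ⟨_, ⟨a, rfl⟩, rfl⟩
    have h1 := hNv a
    rcases hv1 a with h | h <;> rw [h] at h1
    · left; linarith
    · right; linarith
  · rintro (rfl | rfl)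
    · obtain ⟨a, ha⟩ := hconst 1 (Or.inl rfl)
      refine ⟨_, ⟨a, rfl⟩, ?_⟩
      have h1 := hNv a
      rw [ha] at h1; linarith
    · obtain ⟨a, ha⟩ := hconst (-1) (Or.inr rfl)
      refine ⟨_, ⟨a, rfl⟩, ?_⟩
      have h1 := hNv a
      rw [ha] at h1; linarith

/-! ### Norms from the quadratic extension and quartic classes. -/

theorem Complex.I_zpow_eq_I_zpow_iff {a b : ℤ} : Complex.I ^ a = Complex.I ^ b ↔ 4 ∣ a - b := by
  rw [← div_eq_one_iff_eq (zpow_ne_zero _ Complex.I_ne_zero), ← zpow_sub₀ Complex.I_ne_zero]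
  have : IsPrimitiveRoot Complex.I 4 := by
    have := Complex.isPrimitiveRoot_exp 4 (by norm_num)
    rwa [show (2 * Real.pi * Complex.I / ((4 : ℕ) : ℂ)) = Real.pi / 2 * Complex.I by
      push_cast; ring, Complex.exp_pi_div_two_mul_I] at this
  exact_mod_cast this.zpow_eq_one_iff_dvd (a - b)

theorem MulChar.map_units_zpow {M R : Type*} [CommMonoid M] [Field R] (χ : MulChar M R)
    (g : Mˣ) (k : ℤ) : χ ((g ^ k : Mˣ) : M) = χ g ^ k := by
  rw [← MulChar.coe_toUnitHom, map_zpow, Units.val_zpow_eq_zpow_val, MulChar.coe_toUnitHom]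

section QuadraticExtension

variable {F E : Type*} [Field F] [Fintype F] [Field E] [Algebra F E]

theorem exists_generator_algebraMap_eq_pow [Fintype E]
    (hE : Fintype.card E = Fintype.card F ^ 2) {ω : Eˣ}
    (hω : ∀ x : Eˣ, x ∈ Subgroup.zpowers ω) :
    ∃ g : Fˣ, (∀ x, x ∈ Subgroup.zpowers g) ∧
      algebraMap F E g = (ω : E) ^ (Fintype.card F + 1) := by
  refine ⟨Units.map (Algebra.norm F) ω, ?_, ?_⟩
  · intro x
    obtain ⟨y, rfl⟩ := FiniteField.unitsMap_norm_surjective F E x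
    obtain ⟨k, rfl⟩ := hω y
    exact ⟨k, by simp⟩
  · rw [Units.coe_map, FiniteField.algebraMap_norm_eq_pow,
      Nat.card_eq_fintype_card, Nat.card_eq_fintype_card, hE]
    congr 1
    have h1 := Fintype.one_lt_card (α := F)
    obtain ⟨c, hc⟩ : ∃ c, Fintype.card F = c + 2 := ⟨Fintype.card F - 2, by omega⟩
    rw [hc]
    apply Nat.div_eq_of_eq_mul_left (by omega)
    have : (c + 2) ^ 2 = (c + 2 + 1) * (c + 1) + 1 := by ring
    rw [this]; rfl

theorem exists_algebraMap_eq_add_pow_card [Fintype E]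
    (hE : Fintype.card E = Fintype.card F ^ 2) (x : E) :
    ∃ t : F, algebraMap F E t = x + x ^ Fintype.card F := by
  refine ⟨Algebra.trace F E x, ?_⟩
  have hfr : Module.finrank F E = 2 := by
    have := Module.card_eq_pow_finrank (K := F) (V := E)
    rw [hE] at this
    exact (Nat.pow_right_injective Fintype.one_lt_card this).symm
  rw [FiniteField.algebraMap_trace_eq_sum_pow, hfr, sum_range_succ, sum_range_one,
    Nat.card_eq_fintype_card, pow_zero, pow_one, pow_one]

/-- If `z = ω^k`, its norm is `y = g^k` and `χ y = i^k`; both sides say `k ≡ i` modulo `4`.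
Comparing values of `χ` avoids the ambiguity of `k`. -/
theorem mem_cyclotomicClass_four_iff {ω : Eˣ} (hω : ∀ x : Eˣ, x ∈ Subgroup.zpowers ω)
    {g : Fˣ} (hgω : algebraMap F E g = (ω : E) ^ (Fintype.card F + 1)) {χ : MulChar F ℂ}
    (hχ : χ g = Complex.I) {y : F} {z : E} (hz : z ≠ 0)
    (hy : algebraMap F E y = z ^ (Fintype.card F + 1)) (i : ℕ) :
    z ∈ cyclotomicClass ω 4 i ↔ χ y = Complex.I ^ i := by
  obtain ⟨k, hk⟩ := hω (Units.mk0 z hz)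
  have hk' : z = ((ω ^ k : Eˣ) : E) := by rw [show ω ^ k = Units.mk0 z hz from hk]; rfl
  have hyk : y = ((g ^ k : Fˣ) : F) := by
    apply (algebraMap F E).injective
    rw [hy, hk', Units.val_zpow_eq_zpow_val, Units.val_zpow_eq_zpow_val, map_zpow₀, hgω,
      ← zpow_natCast, ← zpow_natCast, ← zpow_mul, ← zpow_mul, mul_comm]
  have hχy : χ y = Complex.I ^ k := by
    rw [hyk, MulChar.map_units_zpow, hχ]
  rw [hχy, ← zpow_natCast, Complex.I_zpow_eq_I_zpow_iff]
  constructor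
  · rintro ⟨_, ⟨c, rfl⟩, hc⟩
    obtain ⟨j, rfl⟩ := hω c
    have h1 : z = ((ω ^ ((i : ℤ) + 4 * j) : Eˣ) : E) := by
      rw [hc, zpow_add, zpow_natCast, zpow_mul', powMonoidHom_apply]
      norm_cast
    have h2 : y = ((g ^ ((i : ℤ) + 4 * j) : Fˣ) : F) := by
      apply (algebraMap F E).injective
      rw [hy, h1, Units.val_zpow_eq_zpow_val, Units.val_zpow_eq_zpow_val, map_zpow₀, hgω,
        ← zpow_natCast, ← zpow_natCast, ← zpow_mul, ← zpow_mul, mul_comm]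
    have h3 : χ y = Complex.I ^ ((i : ℤ) + 4 * j) := by
      rw [h2, MulChar.map_units_zpow, hχ]
    rw [hχy, Complex.I_zpow_eq_I_zpow_iff] at h3
    omega
  · rintro ⟨j, hj⟩
    refine ⟨(ω ^ j) ^ 4, ⟨ω ^ j, rfl⟩, ?_⟩
    rw [hk', show k = (i : ℤ) + j * 4 by linarith, zpow_add, zpow_mul, zpow_natCast]
    norm_cast

theorem algebraMap_norm_one_add_mul {α : E} {n t : F}
    (hn : algebraMap F E n = α ^ (Fintype.card F + 1))
    (ht : algebraMap F E t = α + α ^ Fintype.card F) (x : F) :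
    algebraMap F E (1 + t * x + n * x ^ 2) =
      (1 + algebraMap F E x * α) ^ (Fintype.card F + 1) := by
  have h := map_add (FiniteField.frobeniusAlgHom F E) 1 (algebraMap F E x * α)
  simp only [FiniteField.coe_frobeniusAlgHom, mul_pow, one_pow, ← map_pow,
    FiniteField.pow_card] at h
  rw [pow_succ (1 + _), h]
  simp only [map_add, map_mul, map_one, map_pow, hn, ht]
  ring

/-- `α` is a root of `X² - tX + n`, so a square discriminant `t² - 4n = (α - α^q)²` in `F` would put
`α` in `F`. -/
theorem quadraticChar_neg_norm_sub_eq_neg_one [DecidableEq F] (hF : ringChar F ≠ 2) {α : E}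
    (hα : ∀ x, algebraMap F E x ≠ α) {n t : F}
    (hn : algebraMap F E n = α ^ (Fintype.card F + 1))
    (ht : algebraMap F E t = α + α ^ Fintype.card F) :
    quadraticChar F (-(n - t ^ 2 / 4)) = -1 := by
  have h2 : (2 : F) ≠ 0 := Ring.two_ne_zero hF
  have h4 : (4 : F) ≠ 0 := by
    rw [show (4 : F) = 2 * 2 by norm_num]; exact mul_ne_zero h2 h2
  rw [quadraticChar_neg_one_iff_not_isSquare]
  rintro ⟨y, hy⟩
  have h2E : (2 : E) ≠ 0 := by
    have := (map_ne_zero (algebraMap F E)).mpr h2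
    rwa [map_ofNat] at this
  have hy' : t ^ 2 - 4 * n = (2 * y) ^ 2 := by
    field_simp at hy
    linear_combination hy
  have h := congrArg (algebraMap F E) hy'
  simp only [map_sub, map_mul, map_pow, map_ofNat, hn, ht] at h
  have hfac : (α - (α ^ Fintype.card F + 2 * algebraMap F E y)) *
      (α - (α ^ Fintype.card F - 2 * algebraMap F E y)) = 0 := by
    linear_combination h
  rcases mul_eq_zero.mp hfac with h | h
  · refine hα (t / 2 + y) (mul_left_cancel₀ h2E ?_)
    simp only [map_add, map_div₀, map_ofNat, ht]
    field_simp
    linear_combination -h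
  · refine hα (t / 2 - y) (mul_left_cancel₀ h2E ?_)
    simp only [map_sub, map_div₀, map_ofNat, ht]
    field_simp
    linear_combination -h

theorem algebraMap_ne_generator [Fintype E]
    (hE : Fintype.card E = Fintype.card F ^ 2) {ω : Eˣ}
    (hω : ∀ x : Eˣ, x ∈ Subgroup.zpowers ω) (x : F) : algebraMap F E x ≠ ω := by
  intro h
  have hx0 : x ≠ 0 := by
    rintro rfl
    exact ω.ne_zero (by rw [← h, map_zero])
  have h1 : ω ^ (Fintype.card F - 1) = 1 := by
    ext
    rw [Units.val_pow_eq_pow_val, ← h, ← map_pow, FiniteField.pow_card_sub_one_eq_one x hx0,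
      map_one, Units.val_one]
  have hq := Fintype.one_lt_card (α := F)
  have h2 := Nat.le_of_dvd (by omega) (orderOf_dvd_of_pow_eq_one h1)
  rw [orderOf_eq_card_of_forall_mem_zpowers hω, Nat.card_units, Nat.card_eq_fintype_card, hE] at h2
  have : Fintype.card F * 2 ≤ Fintype.card F ^ 2 := by rw [pow_two]; gcongr; omega
  omega

end QuadraticExtension

/-! ### Existence of admissible pairs. -/

/-- As `χ(n) = i^ℓ`, the first condition just fixes `h` modulo `4`. For `ℓ = 1` the second holds up
to sign, both sides being `±i`. A wrong sign is repaired by passing to `ω^(q+2) = gω`: `d` becomes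
`g²d`, so `χ(d)` changes sign, while `h` moves by `q + 1 ≡ 2` modulo `4` and `i^(2h)` is unchanged.
-/
theorem exists_admissiblePair {F E : Type*} [Field F] [Fintype F] [Field E] [Fintype E]
    [Algebra F E] [DecidableEq F] (hF : ringChar F ≠ 2) (hF4 : Fintype.card F % 4 = 1)
    (hE : Fintype.card E = Fintype.card F ^ 2) {ω : Eˣ}
    (hω : ∀ x : Eˣ, x ∈ Subgroup.zpowers ω) {χ : MulChar F ℂ}
    (hχ2 : χ ^ 2 = (quadraticChar F).ringHomComp (Int.castRingHom ℂ))
    {g : Fˣ} (hgω : algebraMap F E g = (ω : E) ^ (Fintype.card F + 1)) (hχ : χ g = Complex.I)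
    {ε : ℤ} (hε : ε = 1 ∨ ε = -1) (δ : ℤ) :
    ∃ (h : ℕ) (ℓ : ℤ), 0 ≤ ℓ ∧ ℓ ≤ (Fintype.card F : ℤ) ^ 2 - 2 ∧
        AdmissiblePair ω χ ε δ h ℓ := by
  have hI0 := Complex.I_ne_zero
  set q := Fintype.card F with hq
  have hq5 : 5 ≤ q := by
    have := Fintype.one_lt_card (α := F)
    omega
  set c := (1 - ε * δ) / 2 with hc
  have hχq : ∀ y : F, χ y ^ 2 = (quadraticChar F y : ℂ) := by
    intro y
    rw [← MulChar.pow_apply' _ two_ne_zero, hχ2, MulChar.ringHomComp_apply]; rfl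
  obtain ⟨t, ht⟩ := exists_algebraMap_eq_add_pow_card hE (ω : E)
  have hd := quadraticChar_neg_norm_sub_eq_neg_one hF (algebraMap_ne_generator hE hω) hgω ht
  have hneg : quadraticChar F (-1) = 1 :=
    (quadraticChar_one_iff_isSquare (neg_ne_zero.mpr one_ne_zero)).mpr
      (FiniteField.isSquare_neg_one_iff.mpr (by omega))
  rw [← neg_one_mul, map_mul, hneg, one_mul] at hd
  set d := (g : F) - t ^ 2 / 4 with hddef
  have hd2 : χ d ^ 2 = -1 := by rw [hχq, hd]; norm_num
  let h : ℤ → ℕ := fun ℓ => ((ℓ - c) % 4).toNat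
  have hh : ∀ ℓ, (h ℓ : ℤ) = (ℓ - c) % 4 := fun ℓ =>
    Int.toNat_of_nonneg (Int.emod_nonneg _ (by norm_num))
  have hh4 : ∀ ℓ, h ℓ < 4 := fun ℓ => by have := hh ℓ; omega
  have hI4 : ∀ ℓ, Complex.I ^ ℓ = Complex.I ^ (c + (h ℓ : ℤ)) := by
    intro ℓ
    rw [Complex.I_zpow_eq_I_zpow_iff, hh]
    omega
  have hT : (Complex.I ^ (ε + 2 * (h 1 : ℤ))) ^ 2 = -1 := by
    rw [← zpow_natCast, ← zpow_mul, show (-1 : ℂ) = Complex.I ^ (2 : ℤ) by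
      rw [zpow_ofNat, Complex.I_sq], Complex.I_zpow_eq_I_zpow_iff]
    rcases hε with rfl | rfl <;> push_cast <;> omega
  have hor : χ d = -Complex.I ^ (ε + 2 * (h 1 : ℤ)) ∨ χ d = Complex.I ^ (ε + 2 * (h 1 : ℤ)) :=
    (sq_eq_sq_iff_eq_or_eq_neg.mp (hd2.trans hT.symm)).symm
  rcases hor with hor | hor
  · refine ⟨h 1, 1, by norm_num, by nlinarith, hh4 1, ?_, g, t, ?_, ?_, ?_, hor⟩
    · intro hdvd
      have := Int.le_of_dvd (by norm_num) hdvd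
      rw [Nat.card_eq_fintype_card] at this
      omega
    · rw [hgω, one_mul, Nat.card_eq_fintype_card, ← hq]; norm_cast
    · rw [ht, one_mul, Nat.card_eq_fintype_card, ← hq]; norm_cast; rw [pow_one]
    · rw [hχ, ← hI4, zpow_one]
  · have hωq : (ω : E) ^ ((q : ℤ) + 1) = algebraMap F E g := by rw [hgω]; norm_cast
    have hgq : algebraMap F E g ^ (q : ℤ) = algebraMap F E g := by
      rw [zpow_natCast, ← map_pow, hq, FiniteField.pow_card]
    have hω0 : (ω : E) ≠ 0 := ω.ne_zero
    refine ⟨h (q + 2), q + 2, by omega, by nlinarith, hh4 _, ?_, g ^ 3, g * t, ?_, ?_, ?_, ?_⟩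
    · rw [Nat.card_eq_fintype_card, ← hq]
      intro hdvd
      have := Int.le_of_dvd (by norm_num)
        ((Int.dvd_add_right (dvd_refl ((q : ℤ) + 1))).mp (by convert hdvd using 1; ring :
          (q : ℤ) + 1 ∣ ((q : ℤ) + 1) + 1))
      omega
    · rw [Nat.card_eq_fintype_card, ← hq, Units.val_zpow_eq_zpow_val, mul_comm, zpow_mul, hωq,
        show (q : ℤ) + 2 = q + (2 : ℕ) by norm_num, zpow_add₀ (by simp), hgq, zpow_natCast, map_pow]
      ring
    · rw [Nat.card_eq_fintype_card, ← hq, Units.val_zpow_eq_zpow_val, Units.val_zpow_eq_zpow_val,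
        zpow_mul, show (q : ℤ) + 2 = (q + 1) + 1 by ring, zpow_add₀ hω0, hωq, mul_zpow, hgq,
        map_mul, ht, zpow_one, zpow_natCast]
      ring
    · rw [← hI4, map_pow, hχ, ← zpow_natCast, Complex.I_zpow_eq_I_zpow_iff]
      push_cast; omega
    · rw [show (g : F) ^ 3 - (g * t) ^ 2 / 4 = g ^ 2 * d by rw [hddef]; ring, map_mul, map_pow, hχ,
        Complex.I_sq, hor, neg_one_mul, neg_inj, Complex.I_zpow_eq_I_zpow_iff, hh, hh]
      omega

/-! ### The main theorem. -/

theorem theorem3p3 {F E : Type*} [Field F] [Fintype F] [Field E] [Fintype E] [Algebra F E]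
    (p r : ℕ) (m : ℤ) (hp : p.Prime) (hp4 : p ≡ 1 [MOD 4])
    (hF : Fintype.card F = p ^ r) (hm : (Fintype.card F : ℤ) = 4 * m ^ 2 + 1)
    (hE : Fintype.card E = Fintype.card F ^ 2)
    -- a primitive element of `E`
    (ω : Eˣ) (hω : ∀ x : Eˣ, x ∈ Subgroup.zpowers ω)
    -- the quadratic character of `F`, and the quartic one with `χ (ω ^ (q + 1)) = ζ₄`
    (η χ : MulChar F ℂ) (hη : orderOf η = 2) (hχ : orderOf χ = 4)
    (hχω : ∀ g : F, algebraMap F E g = (ω : E) ^ (Fintype.card F + 1) → χ g = Complex.I) :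
    -- the signs `ε`, `δ` exist and are determined by the Jacobi sum, as `m ≠ 0`
    ∃ ε δ : ℤ, (ε = 1 ∨ ε = -1) ∧ (δ = 1 ∨ δ = -1) ∧
      jacobiSum η χ = (ε : ℂ) + 2 * (m : ℂ) * (δ : ℂ) * Complex.I ∧
      -- admissible pairs exist
      (∃ (h : ℕ) (ℓ : ℤ), 0 ≤ ℓ ∧ ℓ ≤ (Fintype.card F : ℤ) ^ 2 - 2 ∧
        AdmissiblePair ω χ ε δ h ℓ) ∧
      -- each of them gives a two-intersection set
      ∀ (h : ℕ) (ℓ : ℤ), AdmissiblePair ω χ ε δ h ℓ →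
        IsTwoIntersectionSet (squareTranslates F) (quarticSet F ω ℓ h)
          (2 * m ^ 2 - m + 1) (m ^ 2 - m) (m ^ 2) := by
  classical
  obtain ⟨g, hg, hgω⟩ := exists_generator_algebraMap_eq_pow hE hω
  have hχg := hχω g hgω
  have hp41 : p % 4 = 1 := hp4
  have hF4 : Fintype.card F % 4 = 1 := by rw [hF, Nat.pow_mod, hp41]; simp
  have hF2 : ringChar F ≠ 2 := by
    intro h
    have := FiniteField.even_card_iff_char_two.mp h
    omega
  have hηg : η g = -1 := by
    have h2 : η ^ 2 = 1 := by rw [← hη, pow_orderOf_eq_one]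
    have h3 : η g ^ 2 = 1 := by rw [← MulChar.pow_apply_coe, h2, MulChar.one_apply_coe]
    refine (sq_eq_one_iff.mp h3).resolve_left fun h => ?_
    have : η = 1 := (MulChar.eq_iff hg _ _).mpr (by rw [h, MulChar.one_apply_coe])
    rw [this, orderOf_one] at hη
    norm_num at hη
  have hχ2g : (χ ^ 2) g = -1 := by rw [MulChar.pow_apply_coe, hχg, Complex.I_sq]
  -- Both characters take the value `-1` at the generator `g`.
  have hηχ : η = χ ^ 2 := (MulChar.eq_iff hg _ _).mpr (by rw [hηg, hχ2g])
  have hχ2 := eq_quadraticChar_of_generator hF2 hg hχ2g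
  have hχ1 : χ ≠ 1 := by
    rintro rfl
    rw [orderOf_one] at hχ
    norm_num at hχ
  obtain ⟨ε, δ, hε, hδ, hJ⟩ := jacobiSum_sq_self_eq hp hp41 hF hm hg hχg
  rw [hηχ]
  refine ⟨ε, δ, hε, hδ, hJ, exists_admissiblePair hF2 hF4 hE hω hχ2 hgω hχg hε δ, ?_⟩
  rintro h ℓ ⟨-, -, n, t, hn, ht, hχn, hχd⟩
  rw [Nat.card_eq_fintype_card] at hn ht
  rw [zpow_mul, ← Nat.cast_succ, zpow_natCast, Units.val_pow_eq_pow_val] at hn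
  rw [zpow_mul, zpow_natCast, Units.val_pow_eq_pow_val] at ht
  obtain ⟨hP, hmain⟩ := isTwoIntersectionSet_of_quartic_mulChar hF2 hm hχ1 hχ2
    (FiniteField.isSquare_neg_one_iff.mpr (by omega)) hε hδ hJ hχn hχd
  convert hmain using 1
  ext x
  have hN := algebraMap_norm_one_add_mul hn ht x
  have hz : 1 + algebraMap F E x * ((ω ^ ℓ : Eˣ) : E) ≠ 0 := by
    intro h0
    rw [h0, zero_pow (Nat.succ_ne_zero _), map_eq_zero] at hN
    exact hP x hN
  exact or_congr (mem_cyclotomicClass_four_iff hω hgω hχg hz hN h)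
    (mem_cyclotomicClass_four_iff hω hgω hχg hz hN (h + 1))
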